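/- Let $\mathbb T=\{z\in\mathbb C:|z|=1\}$, let $p$ be normalized Lebesgue measure on the two-torus $\mathbb T^2$, and let $\alpha_1,\alpha_2:\mathbb T^2\to\mathbb T^2$ be the measure-preserving automorphisms $\alpha_1(x,y)=(y,x)$ and $\alpha_2(x,y)=(x,xy)$. Let $1<r\le\infty$, and let $L_r(\mathbb T^2)=L_r(\mathbb T^2,p)$ be the space of real-valued or of complex-valued functions. For a measure-preserving map $\tau$ of $(\mathbb T^2,p)$, a function $f\in L_r(\mathbb T^2)$ is called a $\tau$-coboundary if there is $h\in L_r(\mathbb T^2)$ with $f=h-h\circ\tau$ almost everywhere. Then there exists a function $f\in L_r(\mathbb T^2)$ which is an $\alpha_1$-coboundary but not an $\alpha_2$-coboundary. -/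

import Mathlib

open MeasureTheory
open scoped ENNReal

/-- The circle group `𝕋` of unit complex numbers, with its Borel σ-algebra. -/
noncomputable instance Circle.instMeasurableSpaceBorel : MeasurableSpace Circle := borel Circle

instance Circle.instBorelSpaceBorel : BorelSpace Circle := ⟨rfl⟩

/-- Normalized Lebesgue (arc length) measure on the circle: the Haar measure of total mass one. -/
noncomputable def circleMeasure : Measure Circle := Measure.haarMeasure ⊤

instance circleMeasure_isHaarMeasure : circleMeasure.IsHaarMeasure :=
  inferInstanceAs (Measure.haarMeasure ⊤).IsHaarMeasure

instance circleMeasure_isProbabilityMeasure : IsProbabilityMeasure circleMeasure :=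
  ⟨Measure.haarMeasure_self⟩

/-- Normalized Lebesgue measure on the two-torus `𝕋² = 𝕋 × 𝕋`. -/
noncomputable def torusMeasure : Measure (Circle × Circle) := circleMeasure.prod circleMeasure

instance torusMeasure_isProbabilityMeasure : IsProbabilityMeasure torusMeasure :=
  inferInstanceAs (IsProbabilityMeasure (circleMeasure.prod circleMeasure))

/-- The toral automorphism `α₁(x, y) = (y, x)`. -/
def torusSwap (z : Circle × Circle) : Circle × Circle := (z.2, z.1)

/-- The toral automorphism `α₂(x, y) = (x, xy)`. -/
noncomputable def torusShear (z : Circle × Circle) : Circle × Circle := (z.1, z.1 * z.2)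

theorem measurePreserving_torusSwap :
    MeasurePreserving torusSwap torusMeasure torusMeasure :=
  Measure.measurePreserving_swap

theorem measurePreserving_torusShear :
    MeasurePreserving torusShear torusMeasure torusMeasure :=
  measurePreserving_prod_mul circleMeasure circleMeasure

/-- For a measure-preserving map `τ`, a function `f ∈ L_r` is a `τ`-coboundary (with transfer
function in `L_r`) if `f = h - h ∘ τ` for some `h ∈ L_r`. The equality is one of elements of
`L_r`, that is, almost everywhere. -/
def IsCoboundary {X E : Type*} [MeasurableSpace X] [NormedAddCommGroup E] {μ : Measure X}
    {r : ℝ≥0∞} (τ : X → X) (hτ : MeasurePreserving τ μ μ) (f : Lp E r μ) : Prop :=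
  ∃ h : Lp E r μ, f = h - Lp.compMeasurePreserving τ hτ h

/-!
The obstruction is integration against an invariant function: if `φ` is bounded and `φ ∘ τ = φ`,
then `∫ φ (h - h ∘ τ) = ∫ φ h - ∫ (φ h) ∘ τ = 0`, so every `τ`-coboundary annihilates `φ`
(`IsCoboundary.integral_invariant_mul_eq_zero`).

The function `u(x, y) = Re x` is invariant under the shear `α₂` but not under the swap `α₁`. Hence
`f = u - u ∘ α₁`, which is an `α₁`-coboundary by construction, is not an `α₂`-coboundary as soon as
`∫ u f ≠ 0`. Since `α₁` is a measure-preserving involution, `∫ u f = ½ ∫ f²`, and this is positive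
because `f` is continuous and not identically zero (`integral_mul_sub_swap_pos`).
-/

/-- A coboundary in `L_r`, `r ≥ 1`, integrates to zero against every bounded invariant function. -/
theorem IsCoboundary.integral_invariant_mul_eq_zero {X 𝕜 : Type*} [MeasurableSpace X] [RCLike 𝕜]
    {μ : Measure X} [IsFiniteMeasure μ] {r : ℝ≥0∞} (hr : 1 ≤ r) {τ : X → X}
    {hτ : MeasurePreserving τ μ μ} {f : Lp 𝕜 r μ} (hf : IsCoboundary τ hτ f)
    {φ : X → 𝕜} (hφ : MemLp φ ∞ μ) (hinv : φ ∘ τ = φ) :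
    ∫ x, φ x * f x ∂μ = 0 := by
  obtain ⟨h, rfl⟩ := hf
  have hint : Integrable (fun x => φ x * h x) μ :=
    ((Lp.memLp h).integrable hr).mul_of_top_right hφ
  have hae : (fun x => φ x * (h - Lp.compMeasurePreserving τ hτ h : Lp 𝕜 r μ) x) =ᵐ[μ]
      fun x => φ x * h x - φ (τ x) * h (τ x) := by
    filter_upwards [Lp.coeFn_sub h (Lp.compMeasurePreserving τ hτ h),
      Lp.coeFn_compMeasurePreserving h hτ] with x hx hx'
    rw [hx, Pi.sub_apply, hx', Function.comp_apply, mul_sub,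
      show φ (τ x) = φ x from congrFun hinv x]
  have hcomp : ∫ x, φ (τ x) * h (τ x) ∂μ = ∫ x, φ x * h x ∂μ := by
    have hmap := integral_map (f := fun x => φ x * h x) hτ.measurable.aemeasurable
      (by rw [hτ.map_eq]; exact hint.aestronglyMeasurable)
    rw [← hmap, hτ.map_eq]
  have hint' : Integrable (fun x => φ (τ x) * h (τ x)) μ := hτ.integrable_comp_of_integrable hint
  rw [integral_congr_ae hae, integral_sub hint hint', hcomp, sub_self]

/-- The real part of the first coordinate of a point of the torus. -/
noncomputable def reFst (z : Circle × Circle) : ℝ := (z.1 : ℂ).re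

theorem continuous_reFst : Continuous reFst := by
  unfold reFst
  fun_prop

theorem continuous_torusSwap : Continuous torusSwap := continuous_swap

theorem abs_reFst_le_one (z : Circle × Circle) : |reFst z| ≤ 1 :=
  (Complex.abs_re_le_norm _).trans_eq (Circle.norm_coe _)

instance torusMeasure_isOpenPosMeasure : torusMeasure.IsOpenPosMeasure :=
  inferInstanceAs (circleMeasure.prod circleMeasure).IsOpenPosMeasure

/-- Averaging the integral with its image under the swap turns it into half the integral of the
square of `reFst z - reFst (torusSwap z)`. -/
theorem integral_mul_sub_swap_pos :
    0 < ∫ z, reFst z * (reFst z - reFst (torusSwap z)) ∂torusMeasure := by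
  have hu := continuous_reFst
  have hs := hu.comp continuous_torusSwap
  have hint {g : Circle × Circle → ℝ} (hg : Continuous g) : Integrable g torusMeasure :=
    hg.integrable_of_hasCompactSupport (HasCompactSupport.of_compactSpace g)
  have hswap : ∫ z, reFst (torusSwap z) * (reFst (torusSwap z) - reFst z) ∂torusMeasure =
      ∫ z, reFst z * (reFst z - reFst (torusSwap z)) ∂torusMeasure :=
    measurePreserving_torusSwap.integral_comp MeasurableEquiv.prodComm.measurableEmbedding
      fun z => reFst z * (reFst z - reFst (torusSwap z))
  have hsq : 0 < ∫ z, (reFst z - reFst (torusSwap z)) ^ 2 ∂torusMeasure := by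
    have hc : Continuous fun z => (reFst z - reFst (torusSwap z)) ^ 2 := (hu.sub hs).pow 2
    refine hc.integral_pos_of_hasCompactSupport_nonneg_nonzero
      (HasCompactSupport.of_compactSpace _) (fun z => sq_nonneg _) (x := (1, -1)) ?_
    norm_num [reFst, torusSwap]
  have hint₁ : Integrable (fun z => reFst z * (reFst z - reFst (torusSwap z))) torusMeasure :=
    hint (hu.mul (hu.sub hs))
  have hint₂ : Integrable (fun z => reFst (torusSwap z) * (reFst (torusSwap z) - reFst z))
      torusMeasure := hint (hs.mul (hs.sub hu))
  have hadd : ∫ z, (reFst z - reFst (torusSwap z)) ^ 2 ∂torusMeasure =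
      ∫ z, reFst z * (reFst z - reFst (torusSwap z)) ∂torusMeasure +
        ∫ z, reFst (torusSwap z) * (reFst (torusSwap z) - reFst z) ∂torusMeasure := by
    rw [← integral_add hint₁ hint₂]
    congr 1 with z
    ring
  linarith

/-- For every `1 < r ≤ ∞` there is a (real or complex) function `f ∈ L_r(𝕋²)` which is an
`α₁`-coboundary but not an `α₂`-coboundary. -/
theorem mainTheorem9 {𝕜 : Type*} [RCLike 𝕜] (r : ℝ≥0∞) (hr : 1 < r) :
    ∃ f : Lp 𝕜 r torusMeasure,
      IsCoboundary torusSwap measurePreserving_torusSwap f ∧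
        ¬ IsCoboundary torusShear measurePreserving_torusShear f := by
  have hmem (p : ℝ≥0∞) : MemLp (fun z => (reFst z : 𝕜)) p torusMeasure := by
    refine MemLp.of_bound (RCLike.continuous_ofReal.comp continuous_reFst).aestronglyMeasurable 1
      (Filter.Eventually.of_forall fun z => ?_)
    rw [RCLike.norm_ofReal]
    exact abs_reFst_le_one z
  let u : Lp 𝕜 r torusMeasure := (hmem r).toLp
  refine ⟨u - Lp.compMeasurePreserving torusSwap measurePreserving_torusSwap u, ⟨u, rfl⟩,
    fun hcob => integral_mul_sub_swap_pos.ne' ?_⟩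
  -- `reFst` depends only on the first coordinate, which the shear fixes, so invariance is `rfl`.
  have hzero := hcob.integral_invariant_mul_eq_zero hr.le (hmem ∞) rfl
  have hu : u =ᵐ[torusMeasure] fun z => (reFst z : 𝕜) := (hmem r).coeFn_toLp
  have hae : (fun z => (reFst z : 𝕜) *
      (u - Lp.compMeasurePreserving torusSwap measurePreserving_torusSwap u :
        Lp 𝕜 r torusMeasure) z) =ᵐ[torusMeasure]
      fun z => ((reFst z * (reFst z - reFst (torusSwap z)) : ℝ) : 𝕜) := by
    filter_upwards [hu, measurePreserving_torusSwap.quasiMeasurePreserving.ae hu,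
      Lp.coeFn_sub u (Lp.compMeasurePreserving torusSwap measurePreserving_torusSwap u),
      Lp.coeFn_compMeasurePreserving u measurePreserving_torusSwap] with z h₁ h₂ h₃ h₄
    rw [h₃, Pi.sub_apply, h₄, Function.comp_apply, h₁, h₂]
    push_cast
    rfl
  rw [integral_congr_ae hae, integral_ofReal] at hzero
  exact_mod_cast hzero
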